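/- Let $n,m\in\mathbb N$, $A\in\mathbb R^{n\times n}$, $0\ne B\in\mathbb R^{n\times m}$, $K\in\mathbb R$, $\kappa>0$, $b>0$, $z\in\mathbb R^n$, and let $P_t\in\Sigma^n$, where $\Sigma^n$ is the set of symmetric positive semidefinite $n\times n$ matrices. Let $\phi:[0,b^2)\to\mathbb R$ be twice continuously differentiable with $\phi''>0$, $\lim_{\rho\uparrow b^2}\phi(\rho)=\infty$ and $\phi'(0)\ge -K$ (derivatives at $0$ are one-sided). Let $a:[\phi'(0),\infty)\to[-\phi(0),\infty)$, $a(\beta)=\beta\,(\phi')^{-1}(\beta)-\phi((\phi')^{-1}(\beta))$, which is invertible. For $M\ge-\phi(0)$ put $\hat\rho(M)=(\phi')^{-1}(a^{-1}(M))$ and, for $\rho\ge 0$, $$\hat\alpha^{M*}(\rho)=\operatorname*{argmax}_{\alpha\in[-\phi(0),M]}\{a^{-1}(\alpha)\rho-\alpha\},\qquad \Phi^M(\rho)=\sup_{\beta\le a^{-1}(M)}\{\beta\rho-\Theta(\beta)\},\qquad \Theta(\beta)=\sup_{\rho\in[0,b^2)}\{\beta\rho-\phi(\rho)\}.$$ Fix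 $t>0$, $M\ge-\phi(0)$, $x\in\mathbb R^n$. Let $\mathcal U=L^2([0,t];\mathbb R^m)$ and $\mathcal A^M=C([0,t];[-\phi(0),M])$. For $u\in\mathcal U$ let $\chi(x,u)_s=e^{As}x+\int_0^s e^{A(s-\sigma)}Bu_\sigma\,d\sigma$, and with $\xi=\chi(x,u)$ and $\Psi(y)=\frac12\langle y-z,P_t(y-z)\rangle$ define $$\bar J^M(u)=\int_0^t \tfrac K2|\xi_s|^2+\tfrac12\Phi^M(|\xi_s|^2)\,ds+\tfrac\kappa2\|u\|_{\mathcal U}^2+\Psi(\xi_t),$$ $$J(u,\alpha)=\int_0^t \tfrac K2|\xi_s|^2+\tfrac12\big[a^{-1}(\alpha_s)|\xi_s|^2-\alpha_s\big]\,ds+\tfrac\kappa2\|u\|_{\mathcal U}^2+\Psi(\xi_t),\qquad \alpha\in\mathcal A^M .$$ **Theorem.** Suppose that there is a unique triple $P^*\in C([0,t];\Sigma^n)\cap C^1((0,t);\Sigma^n)$, $Q^*,\xi^*\in C([0,t];\mathbb R^n)\cap C^1((0,t);\mathbb R^n)$ such that, for all $s\in(0,t)$, $$-\dot P^*_s=A'P^*_s+P^*_sA-\tfrac1\kappa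 P^*_sBB'P^*_s+\big[K+a^{-1}(\hat\alpha^{M*}(|\xi^*_s|^2))\big]I_n,\qquad P^*_t=P_t,$$ $$-\dot Q^*_s=(A-\tfrac1\kappa BB'P^*_s)'Q^*_s,\qquad Q^*_t=-P_tz,$$ $$\dot\xi^*_s=(A-\tfrac1\kappa BB'P^*_s)\xi^*_s-\tfrac1\kappa BB'Q^*_s,\qquad \xi^*_0=x .$$ For $s\in[0,t]$ define the state feedbacks $$u^*_s=-\tfrac1\kappa B'(P^*_s\xi^*_s+Q^*_s),\qquad \alpha^*_s=\hat\alpha^{M*}(|\xi^*_s|^2).$$ Then: 1. $u^*\in\mathcal U$ is the unique minimizer of $\bar J^M$ over $\mathcal U$. 2. $\chi(x,u^*)=\xi^*$ on $[0,t]$, so that $\alpha^*_s=\hat\alpha^{M*}(|\chi(x,u^*)_s|^2)$. For every $s\in[0,t]$, $\alpha^*_s$ is the unique maximizer of $\alpha\mapsto a^{-1}(\alpha)|\xi^*_s|^2-\alpha$ over $[-\phi(0),M]$, and it equals $a(\phi'(|\xi^*_s|^2))$ if $|\xi^*_s|^2\le\hat\rho(M)$ and $M$ otherwise. 3. $u^*$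 is the unique minimizer of $J(\cdot,\alpha^*)$ over $\mathcal U$. 4. $\alpha^*\in\mathcal A^M$, and $(u^*,\alpha^*)$ is the unique saddle point of the game: $J(u^*,\alpha)\le J(u^*,\alpha^*)\le J(u,\alpha^*)$ for all $u\in\mathcal U$, $\alpha\in\mathcal A^M$. 5. $\displaystyle \inf_{u\in\mathcal U}\bar J^M(u)=\inf_{u\in\mathcal U}\sup_{\alpha\in\mathcal A^M}J(u,\alpha)=\sup_{\alpha\in\mathcal A^M}\inf_{u\in\mathcal U}J(u,\alpha)=J(u^*,\alpha^*).$ -/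

import Mathlib

open Set MeasureTheory Filter Topology
open scoped Matrix

/-- Data of the linear regulator problem: dynamics `ξ' = A ξ + B u`, running cost weights `K`, `κ`,
terminal cost `½ ⟨ξ_t - z, Pt (ξ_t - z)⟩`, and a barrier function `φ` on `[0, b²)`. -/
structure RegulatorData (n m : ℕ) where
  A : Matrix (Fin n) (Fin n) ℝ
  B : Matrix (Fin n) (Fin m) ℝ
  K : ℝ
  κ : ℝ
  Pt : Matrix (Fin n) (Fin n) ℝ
  z : EuclideanSpace ℝ (Fin n)
  b : ℝ
  φ : ℝ → ℝ

namespace RegulatorData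

noncomputable section

variable {n m : ℕ} (d : RegulatorData n m)

/-- The interval `[0, b²)` on which the barrier function `φ` is given. -/
def dom : Set ℝ := Ico 0 (d.b ^ 2)

/-- `φ'` on `[0, b²)`, one-sided at the left end point. -/
def φ' (ρ : ℝ) : ℝ := derivWithin d.φ d.dom ρ

/-- `φ''` on `[0, b²)`, one-sided at the left end point. -/
def φ'' (ρ : ℝ) : ℝ := derivWithin d.φ' d.dom ρ

/-- Standing assumptions on the data. -/
structure Admissible : Prop where
  B_ne_zero : d.B ≠ 0
  κ_pos : 0 < d.κ
  Pt_posSemidef : d.Pt.PosSemidef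
  b_pos : 0 < d.b
  φ_contDiffOn : ContDiffOn ℝ 2 d.φ d.dom
  φ''_pos : ∀ ρ ∈ d.dom, 0 < d.φ'' ρ
  φ_tendsto : Tendsto d.φ (𝓝[<] (d.b ^ 2)) atTop
  neg_K_le : -d.K ≤ d.φ' 0

/-! ### The barrier, its dual, and its approximation -/

/-- `(φ')⁻¹ : [φ'(0), ∞) → [0, b²)`. -/
def φ'Inv (β : ℝ) : ℝ := Function.invFunOn d.φ' d.dom β

/-- The dual function `a(β) = β (φ')⁻¹(β) - φ((φ')⁻¹(β))` for `β ≥ φ'(0)`. -/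
def a (β : ℝ) : ℝ := β * d.φ'Inv β - d.φ (d.φ'Inv β)

/-- `a⁻¹ : [-φ(0), ∞) → [φ'(0), ∞)`. -/
def aInv (α : ℝ) : ℝ := Function.invFunOn d.a (Ici (d.φ' 0)) α

/-- The convex conjugate `Θ(β) = sup_ρ {β ρ - Φ(ρ)}` of the barrier `Φ`, which is `φ` on `[0, b²)`
and `+∞` elsewhere (so that only `ρ ∈ [0, b²)` contributes to the supremum). -/
def Θ (β : ℝ) : ℝ := sSup ((fun ρ => β * ρ - d.φ ρ) '' d.dom)

/-- The approximate barrier `Φ^M(ρ) = sup_{β ≤ a⁻¹(M)} {β ρ - Θ(β)}`; it is used for `ρ ≥ 0`,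
where the supremum is finite. -/
def barrierM (M ρ : ℝ) : ℝ := sSup ((fun β => β * ρ - d.Θ β) '' Iic (d.aInv M))

/-- `ρ̂(M) = (φ')⁻¹(a⁻¹(M))`. -/
def ρHat (M : ℝ) : ℝ := d.φ'Inv (d.aInv M)

/-- `α̂^{M*}(ρ) = argmax_{α ∈ [-φ(0), M]} {a⁻¹(α) ρ - α}`. -/
def αHat (M ρ : ℝ) : ℝ :=
  Classical.epsilon fun α => α ∈ Icc (-d.φ 0) M ∧
    IsMaxOn (fun α' => d.aInv α' * ρ - α') (Icc (-d.φ 0) M) α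

/-! ### Dynamics, costs and values -/

/-- The controls `𝒰[0,t] = L²([0,t]; ℝᵐ)` (as square integrable functions). -/
def controls (_d : RegulatorData n m) (t : ℝ) : Set (ℝ → EuclideanSpace ℝ (Fin m)) :=
  {u | MemLp u 2 (volume.restrict (Icc 0 t))}

/-- Equality in `𝒰[0,t]`: almost everywhere equality on `[0,t]`. -/
def SameControl (_d : RegulatorData n m) (t : ℝ) (u v : ℝ → EuclideanSpace ℝ (Fin m)) : Prop :=
  u =ᵐ[volume.restrict (Icc 0 t)] v

/-- The inputs `𝒜^M[0,t] = C([0,t]; [-φ(0), M])` of the second player. -/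
def barrierInputs (t M : ℝ) : Set (ℝ → ℝ) :=
  {α | ContinuousOn α (Icc 0 t) ∧ MapsTo α (Icc 0 t) (Icc (-d.φ 0) M)}

/-- The trajectory `[χ(x,u)]_s = e^{As} x + ∫_0^s e^{A(s-σ)} B u_σ dσ`. -/
def traj (x : EuclideanSpace ℝ (Fin n)) (u : ℝ → EuclideanSpace ℝ (Fin m)) (s : ℝ) :
    EuclideanSpace ℝ (Fin n) :=
  Matrix.toEuclideanLin (NormedSpace.exp (s • d.A)) x +
    ∫ σ in (0 : ℝ)..s, Matrix.toEuclideanLin (NormedSpace.exp ((s - σ) • d.A) * d.B) (u σ)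

/-- The control cost `(κ/2) ‖u‖²` on `[0,t]`. -/
def controlCost (t : ℝ) (u : ℝ → EuclideanSpace ℝ (Fin m)) : ℝ :=
  d.κ / 2 * ∫ s in (0 : ℝ)..t, ‖u s‖ ^ 2

/-- The terminal cost `Ψ(y) = ½ ⟨y - z, Pt (y - z)⟩`. -/
def terminalCost (y : EuclideanSpace ℝ (Fin n)) : ℝ :=
  1 / 2 * inner ℝ (y - d.z) (Matrix.toEuclideanLin d.Pt (y - d.z))

/-- The cost `J̄_t^M(x,u)` of the approximate regulator problem. -/
def costM (t M : ℝ) (x : EuclideanSpace ℝ (Fin n)) (u : ℝ → EuclideanSpace ℝ (Fin m)) : ℝ :=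
  (∫ s in (0 : ℝ)..t,
      (d.K / 2 * ‖d.traj x u s‖ ^ 2 + 1 / 2 * d.barrierM M (‖d.traj x u s‖ ^ 2))) +
    d.controlCost t u + d.terminalCost (d.traj x u t)

/-- The running cost `ν(x,α) = (K/2) |x|² + ½ (a⁻¹(α) |x|² - α)` of the game. -/
def ν (x : EuclideanSpace ℝ (Fin n)) (α : ℝ) : ℝ :=
  d.K / 2 * ‖x‖ ^ 2 + 1 / 2 * (d.aInv α * ‖x‖ ^ 2 - α)

/-- The cost `J_t(x,u,α)` of the game. -/
def gameCost (t : ℝ) (x : EuclideanSpace ℝ (Fin n)) (u : ℝ → EuclideanSpace ℝ (Fin m))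
    (α : ℝ → ℝ) : ℝ :=
  (∫ s in (0 : ℝ)..t, d.ν (d.traj x u s) (α s)) + d.controlCost t u +
    d.terminalCost (d.traj x u t)

/-- The value of the approximate regulator problem. -/
def valueM (t M : ℝ) (x : EuclideanSpace ℝ (Fin n)) : EReal :=
  ⨅ u ∈ d.controls t, ((d.costM t M x u : ℝ) : EReal)

/-- The upper value of the approximate game. -/
def upperValue (t M : ℝ) (x : EuclideanSpace ℝ (Fin n)) : EReal :=
  ⨅ u ∈ d.controls t, ⨆ α ∈ d.barrierInputs t M, ((d.gameCost t x u α : ℝ) : EReal)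

/-- The lower value of the approximate game. -/
def lowerValue (t M : ℝ) (x : EuclideanSpace ℝ (Fin n)) : EReal :=
  ⨆ α ∈ d.barrierInputs t M, ⨅ u ∈ d.controls t, ((d.gameCost t x u α : ℝ) : EReal)

/-- `u` is, up to almost everywhere equality, the unique minimizer of `F` over `𝒰[0,t]`. -/
def IsUniqueMinimizer (t : ℝ) (F : (ℝ → EuclideanSpace ℝ (Fin m)) → ℝ)
    (u : ℝ → EuclideanSpace ℝ (Fin m)) : Prop :=
  u ∈ d.controls t ∧ IsMinOn F (d.controls t) u ∧
    ∀ v ∈ d.controls t, IsMinOn F (d.controls t) v → d.SameControl t v u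

/-- `(u, α)` is a saddle point of the approximate game. -/
def IsSaddle (t M : ℝ) (x : EuclideanSpace ℝ (Fin n)) (u : ℝ → EuclideanSpace ℝ (Fin m))
    (α : ℝ → ℝ) : Prop :=
  u ∈ d.controls t ∧ α ∈ d.barrierInputs t M ∧
    (∀ α' ∈ d.barrierInputs t M, d.gameCost t x u α' ≤ d.gameCost t x u α) ∧
    ∀ u' ∈ d.controls t, d.gameCost t x u α ≤ d.gameCost t x u' α

/-! ### The two point boundary value problem -/

/-- `(P, Q, ξ)` solves the two point boundary value problem on `[0,t]`, with `P` in
`C([0,t]; Σⁿ) ∩ C¹((0,t); Σⁿ)` and `Q`, `ξ` in `C([0,t]; ℝⁿ) ∩ C¹((0,t); ℝⁿ)`, where `Σⁿ` is the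
set of symmetric positive semidefinite matrices. -/
structure IsTPBVPSolution (t M : ℝ) (x : EuclideanSpace ℝ (Fin n))
    (P : ℝ → Matrix (Fin n) (Fin n) ℝ) (Q ξ : ℝ → EuclideanSpace ℝ (Fin n)) : Prop where
  P_posSemidef : ∀ s ∈ Icc 0 t, (P s).PosSemidef
  P_cont : ContinuousOn P (Icc 0 t)
  Q_cont : ContinuousOn Q (Icc 0 t)
  ξ_cont : ContinuousOn ξ (Icc 0 t)
  P_deriv_cont : ContinuousOn (deriv P) (Ioo 0 t)
  Q_deriv_cont : ContinuousOn (deriv Q) (Ioo 0 t)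
  ξ_deriv_cont : ContinuousOn (deriv ξ) (Ioo 0 t)
  P_eq : ∀ s ∈ Ioo 0 t, HasDerivAt P
    (-(d.Aᵀ * P s + P s * d.A - (1 / d.κ) • (P s * d.B * d.Bᵀ * P s) +
      (d.K + d.aInv (d.αHat M (‖ξ s‖ ^ 2))) • (1 : Matrix (Fin n) (Fin n) ℝ))) s
  Q_eq : ∀ s ∈ Ioo 0 t, HasDerivAt Q
    (-Matrix.toEuclideanLin (d.A - (1 / d.κ) • (d.B * d.Bᵀ * P s))ᵀ (Q s)) s
  ξ_eq : ∀ s ∈ Ioo 0 t, HasDerivAt ξ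
    (Matrix.toEuclideanLin (d.A - (1 / d.κ) • (d.B * d.Bᵀ * P s)) (ξ s) -
      (1 / d.κ) • Matrix.toEuclideanLin (d.B * d.Bᵀ) (Q s)) s
  P_final : P t = d.Pt
  Q_final : Q t = -Matrix.toEuclideanLin d.Pt d.z
  ξ_init : ξ 0 = x

/-- `(P, Q, ξ)` is the unique solution of the two point boundary value problem on `[0,t]`. -/
def IsUniqueTPBVPSolution (t M : ℝ) (x : EuclideanSpace ℝ (Fin n))
    (P : ℝ → Matrix (Fin n) (Fin n) ℝ) (Q ξ : ℝ → EuclideanSpace ℝ (Fin n)) : Prop :=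
  d.IsTPBVPSolution t M x P Q ξ ∧
    ∀ P₁ Q₁ ξ₁, d.IsTPBVPSolution t M x P₁ Q₁ ξ₁ →
      EqOn P₁ P (Icc 0 t) ∧ EqOn Q₁ Q (Icc 0 t) ∧ EqOn ξ₁ ξ (Icc 0 t)

/-- The state feedback `u*_s = -(1/κ) B' (P_s ξ_s + Q_s)`. -/
def feedbackControl (P : ℝ → Matrix (Fin n) (Fin n) ℝ) (Q ξ : ℝ → EuclideanSpace ℝ (Fin n))
    (s : ℝ) : EuclideanSpace ℝ (Fin m) :=
  -(1 / d.κ) • Matrix.toEuclideanLin d.Bᵀ (Matrix.toEuclideanLin (P s) (ξ s) + Q s)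

/-- The state feedback `α*_s = α̂^{M*}(|ξ_s|²)`. -/
def feedbackBarrierInput (M : ℝ) (ξ : ℝ → EuclideanSpace ℝ (Fin n)) (s : ℝ) : ℝ :=
  d.αHat M (‖ξ s‖ ^ 2)

end

end RegulatorData

/-! The argument is that of a saddle point built from a costate. For fixed `u`, the inner
maximization over inputs decouples in time: duality for the convex function `φ` shows that `α ↦
a⁻¹(α)ρ - α` has a unique maximizer on `[-φ(0), M]`, continuous in `ρ`, with maximum `Φ^M(ρ)`
(`Admissible.barrierM_eq`). Hence the regulator cost of `u` is the game cost of `u` against the best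
response to its own trajectory, and it dominates the game cost against every other input.

For the fixed input `α*`, the game cost is quadratic in `u`. It is strongly convex because `K +
a⁻¹(α) ≥ 0`, `Pt ≥ 0` and `κ > 0`. The costate `p = Pξ + Q` solves the adjoint equation and `u* =
-(1/κ)B'p`, so the first variation vanishes at `u*`. The result is quadratic growth, `J(u*,α*) +
(κ/2)‖u - u*‖² ≤ J(u,α*)` (`IsTPBVPSolution.gameCost_add_le`).

Since `u*` generates `ξ`, the input `α*` is the best response to `u*`, so the regulator cost and
`J(·,α*)` agree at `u*`. The growth estimate therefore passes to the larger regulator cost, and both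
optimality and uniqueness follow from it. -/

namespace RegulatorData

/-! ### Convex duality for the barrier -/

noncomputable section Barrier

variable {n m : ℕ} {d : RegulatorData n m}

namespace Admissible

variable (hd : d.Admissible)
include hd

theorem zero_mem_dom : (0 : ℝ) ∈ d.dom := ⟨le_rfl, by have := hd.b_pos; positivity⟩

theorem φ_continuousOn : ContinuousOn d.φ d.dom := hd.φ_contDiffOn.continuousOn

theorem φ'_contDiffOn : ContDiffOn ℝ 1 d.φ' d.dom :=
  hd.φ_contDiffOn.derivWithin (uniqueDiffOn_Ico _ _) (by norm_num)

theorem φ'_continuousOn : ContinuousOn d.φ' d.dom := hd.φ'_contDiffOn.continuousOn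

theorem hasDerivAt_φ {ρ : ℝ} (hρ : ρ ∈ Ioo 0 (d.b ^ 2)) : HasDerivAt d.φ (d.φ' ρ) ρ := by
  have h := (hd.φ_contDiffOn.differentiableOn (by norm_num) ρ (Ioo_subset_Ico_self hρ)).hasDerivWithinAt
  exact h.hasDerivAt (Ico_mem_nhds hρ.1 hρ.2)

theorem φ'_strictMonoOn : StrictMonoOn d.φ' d.dom := by
  refine strictMonoOn_of_deriv_pos (convex_Ico _ _) hd.φ'_continuousOn fun ρ hρ => ?_
  have hρ' : ρ ∈ Ioo 0 (d.b ^ 2) := by simpa [dom] using hρ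
  have := hd.φ''_pos ρ (Ioo_subset_Ico_self hρ')
  rwa [φ'', dom, derivWithin_of_mem_nhds (Ico_mem_nhds hρ'.1 hρ'.2)] at this

/-- The graph of `φ` lies strictly above each tangent line, away from the point of tangency. -/
theorem tangent_lt {ρ r : ℝ} (hρ : ρ ∈ d.dom) (hr : r ∈ d.dom) (hne : r ≠ ρ) :
    d.φ ρ + d.φ' ρ * (r - ρ) < d.φ r := by
  rcases lt_or_gt_of_ne hne with h | h
  · obtain ⟨c, hc, hc'⟩ := exists_hasDerivAt_eq_slope d.φ d.φ' h
      (hd.φ_continuousOn.mono fun y hy => ⟨hr.1.trans hy.1, hy.2.trans_lt hρ.2⟩)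
      fun y hy => hd.hasDerivAt_φ ⟨hr.1.trans_lt hy.1, hy.2.trans hρ.2⟩
    have hlt := hd.φ'_strictMonoOn (a := c) ⟨hr.1.trans hc.1.le, hc.2.trans hρ.2⟩ hρ hc.2
    rw [hc', div_lt_iff₀ (by linarith)] at hlt
    linarith
  · obtain ⟨c, hc, hc'⟩ := exists_hasDerivAt_eq_slope d.φ d.φ' h
      (hd.φ_continuousOn.mono fun y hy => ⟨hρ.1.trans hy.1, hy.2.trans_lt hr.2⟩)
      fun y hy => hd.hasDerivAt_φ ⟨hρ.1.trans_lt hy.1, hy.2.trans hr.2⟩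
    have hlt := hd.φ'_strictMonoOn (b := c) hρ ⟨hρ.1.trans hc.1.le, hc.2.trans hr.2⟩ hc.1
    rw [hc', lt_div_iff₀ (by linarith)] at hlt
    linarith

theorem tangent_le {ρ r : ℝ} (hρ : ρ ∈ d.dom) (hr : r ∈ d.dom) :
    d.φ ρ + d.φ' ρ * (r - ρ) ≤ d.φ r := by
  rcases eq_or_ne r ρ with rfl | h
  · simp
  · exact (hd.tangent_lt hρ hr h).le

/-- The tangent at `ρ`, evaluated at `0`, gives `φ(ρ) ≤ φ(0) + φ'(ρ)ρ`. A bound `φ' ≤ C` would thus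
bound `φ` by `φ(0) + |C|b²`, against the blow-up at `b²`. -/
theorem exists_lt_φ' (C : ℝ) : ∃ ρ ∈ d.dom, C < d.φ' ρ := by
  have hb : 0 < d.b ^ 2 := by have := hd.b_pos; positivity
  obtain ⟨ρ, hρ, hρ'⟩ := ((hd.φ_tendsto.eventually_gt_atTop (|C| * d.b ^ 2 + d.φ 0)).and
    (Ioo_mem_nhdsLT hb)).exists
  have hρd : ρ ∈ d.dom := Ioo_subset_Ico_self hρ'
  refine ⟨ρ, hρd, ?_⟩
  have h := hd.tangent_le hρd hd.zero_mem_dom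
  by_contra! hC
  have : d.φ' ρ * ρ ≤ |C| * d.b ^ 2 :=
    (mul_le_mul_of_nonneg_right (hC.trans (le_abs_self C)) hρ'.1.le).trans
      (mul_le_mul_of_nonneg_left hρ'.2.le (abs_nonneg C))
  linarith

theorem φ'_zero_le {ρ : ℝ} (hρ : ρ ∈ d.dom) : d.φ' 0 ≤ d.φ' ρ :=
  hd.φ'_strictMonoOn.monotoneOn hd.zero_mem_dom hρ hρ.1

theorem φ'_surjOn : SurjOn d.φ' d.dom (Ici (d.φ' 0)) := by
  intro β hβ
  obtain ⟨ρ, hρ, hlt⟩ := hd.exists_lt_φ' β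
  have hsub : Icc 0 ρ ⊆ d.dom := fun y hy => ⟨hy.1, hy.2.trans_lt hρ.2⟩
  obtain ⟨r, hr, hr'⟩ := intermediate_value_Icc hρ.1 (hd.φ'_continuousOn.mono hsub) ⟨hβ, hlt.le⟩
  exact ⟨r, hsub hr, hr'⟩

theorem φ'Inv_mem {β : ℝ} (hβ : d.φ' 0 ≤ β) : d.φ'Inv β ∈ d.dom :=
  Function.invFunOn_mem (hd.φ'_surjOn hβ)

theorem φ'_φ'Inv {β : ℝ} (hβ : d.φ' 0 ≤ β) : d.φ' (d.φ'Inv β) = β :=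
  Function.invFunOn_eq (hd.φ'_surjOn hβ)

theorem φ'Inv_φ' {ρ : ℝ} (hρ : ρ ∈ d.dom) : d.φ'Inv (d.φ' ρ) = ρ :=
  hd.φ'_strictMonoOn.injOn (hd.φ'Inv_mem (hd.φ'_zero_le hρ)) hρ (hd.φ'_φ'Inv (hd.φ'_zero_le hρ))

theorem a_φ' {ρ : ℝ} (hρ : ρ ∈ d.dom) : d.a (d.φ' ρ) = d.φ' ρ * ρ - d.φ ρ := by
  rw [a, hd.φ'Inv_φ' hρ]

theorem a_φ'_zero : d.a (d.φ' 0) = -d.φ 0 := by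
  rw [hd.a_φ' hd.zero_mem_dom]; ring

/-- The Fenchel-Young inequality for `φ` and `a`. -/
theorem fenchel_le {β ρ : ℝ} (hβ : d.φ' 0 ≤ β) (hρ : ρ ∈ d.dom) : β * ρ - d.φ ρ ≤ d.a β := by
  have := hd.tangent_le (hd.φ'Inv_mem hβ) hρ
  rw [hd.φ'_φ'Inv hβ] at this
  rw [a]; linarith

theorem fenchel_lt {β ρ : ℝ} (hβ : d.φ' 0 ≤ β) (hρ : ρ ∈ d.dom) (hne : β ≠ d.φ' ρ) :
    β * ρ - d.φ ρ < d.a β := by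
  have hne' : ρ ≠ d.φ'Inv β := by
    rintro rfl
    exact hne (hd.φ'_φ'Inv hβ).symm
  have := hd.tangent_lt (hd.φ'Inv_mem hβ) hρ hne'
  rw [hd.φ'_φ'Inv hβ] at this
  rw [a]; linarith

/-- Testing the strict Fenchel-Young inequality for `γ` at `r = (φ')⁻¹(β)` gives `a(γ) > a(β) + (γ -
β)r` with `r ≥ 0`. No derivative of `(φ')⁻¹` is needed, and `r = 0` is covered. -/
theorem a_strictMonoOn : StrictMonoOn d.a (Ici (d.φ' 0)) := by
  intro β hβ γ hγ hlt
  have hr := hd.φ'Inv_mem hβ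
  have h := hd.fenchel_lt hγ hr (by rw [hd.φ'_φ'Inv hβ]; exact hlt.ne')
  have := mul_nonneg (sub_nonneg.2 hlt.le) hr.1
  rw [a]; linarith

theorem a_comp_φ'_continuousOn : ContinuousOn (fun ρ => d.a (d.φ' ρ)) d.dom :=
  ((hd.φ'_continuousOn.mul continuousOn_id).sub hd.φ_continuousOn).congr fun _ hρ => hd.a_φ' hρ

theorem neg_φ_zero_le_a {β : ℝ} (hβ : d.φ' 0 ≤ β) : -d.φ 0 ≤ d.a β := by
  rw [← hd.a_φ'_zero]
  exact hd.a_strictMonoOn.monotoneOn self_mem_Ici hβ hβ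

theorem a_surjOn : SurjOn d.a (Ici (d.φ' 0)) (Ici (-d.φ 0)) := by
  intro α hα
  have hb : 0 < d.b ^ 2 := by have := hd.b_pos; positivity
  have hmid : d.b ^ 2 / 2 ∈ d.dom := ⟨by positivity, by linarith⟩
  -- With `c = b²/2 > 0`, Fenchel-Young gives `a(φ'(ρ)) ≥ φ'(ρ)c - φ(c)`, which exceeds `α` once
  -- `φ'(ρ)` is this large.
  obtain ⟨ρ, hρ, hlt⟩ := hd.exists_lt_φ' ((α + d.φ (d.b ^ 2 / 2)) / (d.b ^ 2 / 2))
  rw [div_lt_iff₀ (by positivity)] at hlt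
  have hle := hd.fenchel_le (hd.φ'_zero_le hρ) hmid
  have hsub : Icc 0 ρ ⊆ d.dom := fun y hy => ⟨hy.1, hy.2.trans_lt hρ.2⟩
  obtain ⟨r, hr, hr'⟩ := intermediate_value_Icc hρ.1 (hd.a_comp_φ'_continuousOn.mono hsub)
    (show α ∈ Icc (d.a (d.φ' 0)) _ from ⟨by rw [hd.a_φ'_zero]; exact hα, by linarith⟩)
  exact ⟨d.φ' r, hd.φ'_zero_le (hsub hr), hr'⟩

theorem aInv_mem {α : ℝ} (hα : -d.φ 0 ≤ α) : d.φ' 0 ≤ d.aInv α :=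
  Function.invFunOn_mem (hd.a_surjOn hα)

theorem a_aInv {α : ℝ} (hα : -d.φ 0 ≤ α) : d.a (d.aInv α) = α :=
  Function.invFunOn_eq (hd.a_surjOn hα)

theorem aInv_a {β : ℝ} (hβ : d.φ' 0 ≤ β) : d.aInv (d.a β) = β :=
  hd.a_strictMonoOn.injOn (hd.aInv_mem (hd.neg_φ_zero_le_a hβ)) hβ
    (hd.a_aInv (hd.neg_φ_zero_le_a hβ))

theorem aInv_neg_φ_zero : d.aInv (-d.φ 0) = d.φ' 0 := by
  rw [← hd.a_φ'_zero, hd.aInv_a le_rfl]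

theorem aInv_strictMonoOn : StrictMonoOn d.aInv (Ici (-d.φ 0)) := fun α hα γ hγ hlt => by
  rw [← hd.a_strictMonoOn.lt_iff_lt (hd.aInv_mem hα) (hd.aInv_mem hγ), hd.a_aInv hα, hd.a_aInv hγ]
  exact hlt

/-- An order isomorphism between two half-lines is automatically continuous. -/
theorem aInv_continuousOn : ContinuousOn d.aInv (Ici (-d.φ 0)) := by
  let e : Ici (-d.φ 0) ≃o Ici (d.φ' 0) :=
    { toFun := fun α => ⟨d.aInv α, hd.aInv_mem α.2⟩
      invFun := fun β => ⟨d.a β, hd.neg_φ_zero_le_a β.2⟩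
      left_inv := fun α => Subtype.ext (hd.a_aInv α.2)
      right_inv := fun β => Subtype.ext (hd.aInv_a β.2)
      map_rel_iff' := fun {α γ} => hd.aInv_strictMonoOn.le_iff_le α.2 γ.2 }
  rw [continuousOn_iff_continuous_domRestrict]
  exact continuous_subtype_val.comp e.continuous

/-- This is where `φ'(0) ≥ -K` enters: it makes the running cost of the game convex in the state. -/
theorem K_add_aInv_nonneg {α : ℝ} (hα : -d.φ 0 ≤ α) : 0 ≤ d.K + d.aInv α := by
  have := hd.aInv_mem hα
  have := hd.neg_K_le
  linarith

theorem Θ_eq_a {β : ℝ} (hβ : d.φ' 0 ≤ β) : d.Θ β = d.a β :=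
  IsGreatest.csSup_eq ⟨⟨d.φ'Inv β, hd.φ'Inv_mem hβ, rfl⟩,
    forall_mem_image.2 fun _ hρ => hd.fenchel_le hβ hρ⟩

theorem Θ_eq_neg_φ_zero {β : ℝ} (hβ : β ≤ d.φ' 0) : d.Θ β = -d.φ 0 := by
  refine IsGreatest.csSup_eq ⟨⟨0, hd.zero_mem_dom, by simp⟩, forall_mem_image.2 fun ρ hρ => ?_⟩
  have h := hd.tangent_le hd.zero_mem_dom hρ
  have := mul_le_mul_of_nonneg_right hβ hρ.1
  linarith

theorem ρHat_mem {M : ℝ} (hM : -d.φ 0 ≤ M) : d.ρHat M ∈ d.dom := hd.φ'Inv_mem (hd.aInv_mem hM)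

theorem φ'_ρHat {M : ℝ} (hM : -d.φ 0 ≤ M) : d.φ' (d.ρHat M) = d.aInv M :=
  hd.φ'_φ'Inv (hd.aInv_mem hM)

/-- The unique maximizer of `α ↦ a⁻¹(α) ρ - α` over `[-φ(0), M]` is `a(φ'(min ρ ρ̂(M)))`. -/
theorem lt_of_ne_a_φ'_min {M ρ α : ℝ} (hM : -d.φ 0 ≤ M) (hρ : 0 ≤ ρ) (hα : α ∈ Icc (-d.φ 0) M)
    (hne : α ≠ d.a (d.φ' (min ρ (d.ρHat M)))) :
    d.aInv α * ρ - α < d.aInv (d.a (d.φ' (min ρ (d.ρHat M)))) * ρ -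
      d.a (d.φ' (min ρ (d.ρHat M))) := by
  have hr := hd.ρHat_mem hM
  have hβ := hd.aInv_mem hα.1
  have hmin : min ρ (d.ρHat M) ∈ d.dom := ⟨le_min hρ hr.1, (min_le_right _ _).trans_lt hr.2⟩
  have hneβ : d.aInv α ≠ d.φ' (min ρ (d.ρHat M)) := fun h => hne (by rw [← h, hd.a_aInv hα.1])
  have hlt := hd.fenchel_lt hβ hmin hneβ
  rw [hd.a_aInv hα.1] at hlt
  rw [hd.aInv_a (hd.φ'_zero_le hmin), hd.a_φ' hmin]
  rcases le_total ρ (d.ρHat M) with h | h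
  · rw [min_eq_left h] at *
    linarith
  · rw [min_eq_right h, hd.φ'_ρHat hM] at *
    -- Beyond `ρ̂(M)`, the strict inequality at `ρ̂(M)` is extended to `ρ` by adding `(a⁻¹(M) -
    -- a⁻¹(α))(ρ - ρ̂(M)) ≥ 0`.
    have hle : d.aInv α ≤ d.aInv M := hd.aInv_strictMonoOn.monotoneOn hα.1 hM hα.2
    have := mul_nonneg (sub_nonneg.2 hle) (sub_nonneg.2 h)
    linarith

theorem a_φ'_min_mem {M ρ : ℝ} (hM : -d.φ 0 ≤ M) (hρ : 0 ≤ ρ) :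
    d.a (d.φ' (min ρ (d.ρHat M))) ∈ Icc (-d.φ 0) M := by
  have hr := hd.ρHat_mem hM
  have hmin : min ρ (d.ρHat M) ∈ d.dom := ⟨le_min hρ hr.1, (min_le_right _ _).trans_lt hr.2⟩
  refine ⟨hd.neg_φ_zero_le_a (hd.φ'_zero_le hmin), ?_⟩
  calc d.a (d.φ' (min ρ (d.ρHat M))) ≤ d.a (d.φ' (d.ρHat M)) :=
        hd.a_strictMonoOn.monotoneOn (hd.φ'_zero_le hmin) (hd.φ'_zero_le hr)
          (hd.φ'_strictMonoOn.monotoneOn hmin hr (min_le_right _ _))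
    _ = M := by rw [hd.φ'_ρHat hM, hd.a_aInv hM]

/-- `αHat` is some chosen maximizer; strictness leaves only one candidate. -/
theorem αHat_eq {M ρ : ℝ} (hM : -d.φ 0 ≤ M) (hρ : 0 ≤ ρ) :
    d.αHat M ρ = d.a (d.φ' (min ρ (d.ρHat M))) := by
  have hmem := hd.a_φ'_min_mem hM hρ
  have hmax : IsMaxOn (fun α => d.aInv α * ρ - α) (Icc (-d.φ 0) M)
      (d.a (d.φ' (min ρ (d.ρHat M)))) := fun α hα => by
    rcases eq_or_ne α (d.a (d.φ' (min ρ (d.ρHat M)))) with rfl | hne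
    · exact le_refl (d.aInv (d.a (d.φ' (min ρ (d.ρHat M)))) * ρ - _)
    · exact (hd.lt_of_ne_a_φ'_min hM hρ hα hne).le
  have hspec := Classical.epsilon_spec (p := fun α => α ∈ Icc (-d.φ 0) M ∧
    IsMaxOn (fun α' => d.aInv α' * ρ - α') (Icc (-d.φ 0) M) α) ⟨_, hmem, hmax⟩
  by_contra hne
  exact (hd.lt_of_ne_a_φ'_min hM hρ hspec.1 hne).not_ge (hspec.2 hmem)

theorem αHat_mem {M ρ : ℝ} (hM : -d.φ 0 ≤ M) (hρ : 0 ≤ ρ) : d.αHat M ρ ∈ Icc (-d.φ 0) M := by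
  rw [hd.αHat_eq hM hρ]; exact hd.a_φ'_min_mem hM hρ

theorem lt_αHat {M ρ α : ℝ} (hM : -d.φ 0 ≤ M) (hρ : 0 ≤ ρ) (hα : α ∈ Icc (-d.φ 0) M)
    (hne : α ≠ d.αHat M ρ) :
    d.aInv α * ρ - α < d.aInv (d.αHat M ρ) * ρ - d.αHat M ρ := by
  rw [hd.αHat_eq hM hρ] at *
  exact hd.lt_of_ne_a_φ'_min hM hρ hα hne

theorem le_αHat {M ρ α : ℝ} (hM : -d.φ 0 ≤ M) (hρ : 0 ≤ ρ) (hα : α ∈ Icc (-d.φ 0) M) :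
    d.aInv α * ρ - α ≤ d.aInv (d.αHat M ρ) * ρ - d.αHat M ρ := by
  rcases eq_or_ne α (d.αHat M ρ) with rfl | hne
  · exact le_rfl
  · exact (hd.lt_αHat hM hρ hα hne).le

theorem αHat_of_le {M ρ : ℝ} (hM : -d.φ 0 ≤ M) (hρ : 0 ≤ ρ) (h : ρ ≤ d.ρHat M) :
    d.αHat M ρ = d.a (d.φ' ρ) := by
  rw [hd.αHat_eq hM hρ, min_eq_left h]

theorem αHat_of_lt {M ρ : ℝ} (hM : -d.φ 0 ≤ M) (hρ : 0 ≤ ρ) (h : d.ρHat M < ρ) :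
    d.αHat M ρ = M := by
  rw [hd.αHat_eq hM hρ, min_eq_right h.le, hd.φ'_ρHat hM, hd.a_aInv hM]

theorem αHat_continuousOn {M : ℝ} (hM : -d.φ 0 ≤ M) : ContinuousOn (d.αHat M) (Ici 0) := by
  have hr := hd.ρHat_mem hM
  refine (hd.a_comp_φ'_continuousOn.comp
    (continuous_id.min continuous_const : Continuous fun ρ : ℝ => min ρ (d.ρHat M)).continuousOn
    fun ρ hρ => ?_).congr fun ρ hρ => hd.αHat_eq hM hρ
  exact ⟨le_min hρ hr.1, (min_le_right _ _).trans_lt hr.2⟩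

/-- The substitution `β = a⁻¹(α)` covers all `β ≥ φ'(0)`. Smaller `β` gain nothing: `Θ` is constant
there and `ρ ≥ 0`, so `β = φ'(0)` is at least as good. -/
theorem barrierM_eq {M ρ : ℝ} (hM : -d.φ 0 ≤ M) (hρ : 0 ≤ ρ) :
    d.barrierM M ρ = d.aInv (d.αHat M ρ) * ρ - d.αHat M ρ := by
  have hmem := hd.αHat_mem hM hρ
  refine IsGreatest.csSup_eq ⟨⟨d.aInv (d.αHat M ρ),
    hd.aInv_strictMonoOn.monotoneOn hmem.1 hM hmem.2, ?_⟩, forall_mem_image.2 fun β hβ => ?_⟩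
  · dsimp only
    rw [hd.Θ_eq_a (hd.aInv_mem hmem.1), hd.a_aInv hmem.1]
  · rcases le_total (d.φ' 0) β with h | h
    · rw [hd.Θ_eq_a h]
      have := hd.le_αHat hM hρ (α := d.a β) ⟨hd.neg_φ_zero_le_a h, by
        rw [← hd.a_aInv hM]
        exact hd.a_strictMonoOn.monotoneOn h (hd.aInv_mem hM) hβ⟩
      rwa [hd.aInv_a h] at this
    · rw [hd.Θ_eq_neg_φ_zero h]
      have := hd.le_αHat hM hρ (α := -d.φ 0) ⟨le_rfl, hM⟩
      rw [hd.aInv_neg_φ_zero] at this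
      have := mul_le_mul_of_nonneg_right h hρ
      linarith

end Admissible

end Barrier

end RegulatorData

/-! ### Linear dynamics with integrable forcing -/

section LinearDynamics

variable {E F G : Type*} [NormedAddCommGroup E] [NormedSpace ℝ E] [NormedAddCommGroup F]
  [NormedSpace ℝ F] [NormedAddCommGroup G] [NormedSpace ℝ G]

theorem IntervalIntegrable.bilin_continuousOn (L : E →L[ℝ] F →L[ℝ] G) {f : ℝ → E} {g : ℝ → F}
    {a b : ℝ} (hf : IntervalIntegrable f volume a b) (hg : ContinuousOn g (uIcc a b)) :
    IntervalIntegrable (fun s => L (f s) (g s)) volume a b := by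
  rw [intervalIntegrable_iff] at *
  obtain ⟨C, hC⟩ := isCompact_uIcc.exists_bound_of_continuousOn hg
  have hg' := (hg.mono uIoc_subset_uIcc).aestronglyMeasurable (μ := volume)
    measurableSet_uIoc
  refine Integrable.mono' (hf.norm.const_mul (‖L‖ * C))
    (L.aestronglyMeasurable_comp₂ hf.aestronglyMeasurable hg')
    (ae_restrict_of_forall_mem measurableSet_uIoc fun s hs => ?_)
  calc ‖L (f s) (g s)‖ ≤ ‖L‖ * ‖f s‖ * ‖g s‖ := L.le_opNorm₂ _ _
    _ ≤ ‖L‖ * ‖f s‖ * C := by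
        gcongr
        exact hC s (uIoc_subset_uIcc hs)
    _ = ‖L‖ * C * ‖f s‖ := by ring

theorem IntervalIntegrable.clm_apply_of_continuousOn {Φ : ℝ → E →L[ℝ] F} {f : ℝ → E} {a b : ℝ}
    (hf : IntervalIntegrable f volume a b) (hΦ : ContinuousOn Φ (uIcc a b)) :
    IntervalIntegrable (fun s => Φ s (f s)) volume a b :=
  hf.bilin_continuousOn (ContinuousLinearMap.id ℝ (E →L[ℝ] F)).flip hΦ

/-- Integration by parts for two primitives of integrable functions. -/
theorem intervalIntegral.integral_mul_primitive_add {f g : ℝ → ℝ} {t : ℝ}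
    (hf : IntervalIntegrable f volume 0 t) (hg : IntervalIntegrable g volume 0 t) (c : ℝ) :
    ∫ s in (0 : ℝ)..t, (f s * (c + ∫ σ in (0 : ℝ)..s, g σ) + (∫ σ in (0 : ℝ)..s, f σ) * g s) =
      (∫ σ in (0 : ℝ)..t, f σ) * (c + ∫ σ in (0 : ℝ)..t, g σ) := by
  -- Primitives of integrable functions are absolutely continuous, which suffices for the
  -- fundamental theorem applied to their product.
  have hF := hf.absolutelyContinuousOnInterval_intervalIntegral (c := 0) left_mem_uIcc
  have hG := hg.absolutelyContinuousOnInterval_intervalIntegral (c := 0) left_mem_uIcc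
  have hc : AbsolutelyContinuousOnInterval (fun _ : ℝ => c) 0 t :=
    (LipschitzWith.const c).lipschitzOnWith.absolutelyContinuousOnInterval
  have h := (hF.fun_mul (hc.fun_add hG)).integral_deriv_eq_sub
  simp only [intervalIntegral.integral_same, zero_mul, sub_zero] at h
  rw [← h]
  refine intervalIntegral.integral_congr_ae ?_
  filter_upwards [hf.ae_hasDerivAt_integral, hg.ae_hasDerivAt_integral] with s h1 h2 hs
  have hs' := uIoc_subset_uIcc hs
  exact ((h1 hs' 0 left_mem_uIcc).mul ((h2 hs' 0 left_mem_uIcc).const_add c)).deriv.symm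

theorem intervalIntegral.integral_inner_primitive_add {n : ℕ}
    {f g : ℝ → EuclideanSpace ℝ (Fin n)} {t : ℝ}
    (hf : IntervalIntegrable f volume 0 t) (hg : IntervalIntegrable g volume 0 t)
    (c : EuclideanSpace ℝ (Fin n)) :
    ∫ s in (0 : ℝ)..t, (inner ℝ (f s) (c + ∫ σ in (0 : ℝ)..s, g σ) +
        inner ℝ (∫ σ in (0 : ℝ)..s, f σ) (g s)) =
      inner ℝ (∫ σ in (0 : ℝ)..t, f σ) (c + ∫ σ in (0 : ℝ)..t, g σ) := by
  have key : ∀ {h : ℝ → EuclideanSpace ℝ (Fin n)} (_ : IntervalIntegrable h volume 0 t) (i : Fin n),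
      IntervalIntegrable (fun s => h s i) volume 0 t ∧
      ∀ s ∈ uIcc 0 t, (∫ σ in (0 : ℝ)..s, h σ) i = ∫ σ in (0 : ℝ)..s, h σ i := fun {h} hh i =>
    ⟨(EuclideanSpace.proj (𝕜 := ℝ) i).integrable_comp hh.1 |> fun h1 =>
      ⟨h1, (EuclideanSpace.proj (𝕜 := ℝ) i).integrable_comp hh.2⟩, fun s hs =>
      ((EuclideanSpace.proj (𝕜 := ℝ) i).intervalIntegral_comp_comm
        (hh.mono_set (uIcc_subset_uIcc_left hs))).symm⟩
  have hcont : ∀ {h : ℝ → ℝ} (_ : IntervalIntegrable h volume 0 t),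
      ContinuousOn (fun s => ∫ σ in (0 : ℝ)..s, h σ) (uIcc 0 t) := fun hh =>
    intervalIntegral.continuousOn_primitive_interval' hh left_mem_uIcc
  calc _ = ∫ s in (0 : ℝ)..t, ∑ i, (f s i * (c i + ∫ σ in (0 : ℝ)..s, g σ i) +
        (∫ σ in (0 : ℝ)..s, f σ i) * g s i) := by
        refine intervalIntegral.integral_congr fun s hs => ?_
        simp only [PiLp.inner_apply, PiLp.add_apply, RCLike.inner_apply, conj_trivial,
          (key hf _).2 s hs, (key hg _).2 s hs, ← Finset.sum_add_distrib]
        refine Finset.sum_congr rfl fun i _ => ?_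
        ring
    _ = ∑ i, (∫ σ in (0 : ℝ)..t, f σ i) * (c i + ∫ σ in (0 : ℝ)..t, g σ i) := by
        rw [intervalIntegral.integral_finsetSum]
        · exact Finset.sum_congr rfl fun i _ =>
            intervalIntegral.integral_mul_primitive_add (key hf i).1 (key hg i).1 _
        · exact fun i _ => ((key hf i).1.mul_continuousOn
            (continuousOn_const.add (hcont (key hg i).1))).add
            ((key hg i).1.continuousOn_mul (hcont (key hf i).1))
    _ = _ := by
        simp only [PiLp.inner_apply, PiLp.add_apply, RCLike.inner_apply, conj_trivial,
          (key hf _).2 t right_mem_uIcc, (key hg _).2 t right_mem_uIcc]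
        refine Finset.sum_congr rfl fun i _ => ?_
        ring

variable [CompleteSpace E]

theorem ContinuousLinearMap.exp_smul_continuous (T : E →L[ℝ] E) :
    Continuous fun s : ℝ => NormedSpace.exp (s • T) :=
  continuous_iff_continuousAt.2 fun s => (hasDerivAt_exp_smul_const T s).continuousAt

theorem ContinuousLinearMap.exp_add_smul_apply (T : E →L[ℝ] E) (r s : ℝ) (y : E) :
    NormedSpace.exp ((r + s) • T) y = NormedSpace.exp (r • T) (NormedSpace.exp (s • T) y) := by
  let _ : NormedAlgebra ℚ (E →L[ℝ] E) := NormedAlgebra.restrictScalars ℚ ℝ _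
  rw [add_smul, NormedSpace.exp_add_of_commute (((Commute.refl T).smul_left r).smul_right s)]
  rfl

theorem ContinuousLinearMap.exp_smul_exp_neg_smul_apply (T : E →L[ℝ] E) (s : ℝ) (y : E) :
    NormedSpace.exp (s • T) (NormedSpace.exp ((-s) • T) y) = y := by
  rw [← exp_add_smul_apply, add_neg_cancel, zero_smul, NormedSpace.exp_zero]
  rfl

/-- The variation of constants formula. -/
theorem ContinuousLinearMap.exp_neg_smul_apply_eq (T : E →L[ℝ] E) {p g : ℝ → E} {t : ℝ}
    (hp : ContinuousOn p (Icc 0 t)) (hg : ContinuousOn g (Icc 0 t))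
    (hderiv : ∀ s ∈ Ioo 0 t, HasDerivAt p (T (p s) + g s) s) {s : ℝ} (hs : s ∈ Icc 0 t) :
    NormedSpace.exp ((-s) • T) (p s) =
      p 0 + ∫ σ in (0 : ℝ)..s, NormedSpace.exp ((-σ) • T) (g σ) := by
  have hsub : Icc 0 s ⊆ Icc 0 t := Icc_subset_Icc_right hs.2
  have hexp : Continuous fun σ : ℝ => NormedSpace.exp ((-σ) • T) :=
    T.exp_smul_continuous.comp continuous_neg
  rw [intervalIntegral.integral_eq_sub_of_hasDerivAt_of_le (f := fun σ =>
    NormedSpace.exp ((-σ) • T) (p σ)) hs.1 (hexp.continuousOn.clm_apply (hp.mono hsub))]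
  · simp
  · intro σ hσ
    have h1 : HasDerivAt (fun σ : ℝ => NormedSpace.exp ((-σ) • T))
        (-(NormedSpace.exp ((-σ) • T) * T)) σ := by
      have h := (hasDerivAt_exp_smul_const T (-σ)).scomp σ (hasDerivAt_neg σ)
      rw [neg_one_smul] at h
      exact h
    -- The two terms containing `T (p σ)` cancel, leaving only the forcing `g`.
    have h2 := h1.clm_apply (hderiv σ ⟨hσ.1, hσ.2.trans_le hs.2⟩)
    convert h2 using 1
    simp
  · refine ContinuousOn.intervalIntegrable ?_
    rw [uIcc_of_le hs.1]
    exact hexp.continuousOn.clm_apply (hg.mono hsub)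

end LinearDynamics

/-- Pairing a solution of a linear control system with a solution of the adjoint system. -/
theorem ContinuousLinearMap.inner_adjoint_dynamics {n : ℕ}
    (T : EuclideanSpace ℝ (Fin n) →L[ℝ] EuclideanSpace ℝ (Fin n))
    {f p r w : ℝ → EuclideanSpace ℝ (Fin n)} {t : ℝ} (ht : 0 ≤ t)
    (hf : IntervalIntegrable f volume 0 t) (hp : ContinuousOn p (Icc 0 t))
    (hr : ContinuousOn r (Icc 0 t))
    (hderiv : ∀ s ∈ Ioo 0 t, HasDerivAt p (-(ContinuousLinearMap.adjoint T (p s)) - r s) s)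
    (hw : ∀ s ∈ Icc 0 t, w s = NormedSpace.exp (s • T)
      (∫ σ in (0 : ℝ)..s, NormedSpace.exp ((-σ) • T) (f σ))) :
    inner ℝ (w t) (p t) = ∫ s in (0 : ℝ)..t, (inner ℝ (f s) (p s) - inner ℝ (w s) (r s)) := by
  -- Since `exp(-sS) = exp(sT)*`, the pairing `⟨w, p⟩` equals that of `exp(-sT)w` with `exp(-sS)p`.
  -- Both are primitives, so integration by parts applies although `f` is only integrable.
  set S := -ContinuousLinearMap.adjoint T with hS
  have hadj : ∀ (s : ℝ) (y z : EuclideanSpace ℝ (Fin n)),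
      inner ℝ y (NormedSpace.exp ((-s) • S) z) = inner ℝ (NormedSpace.exp (s • T) y) z := by
    intro s y z
    have : NormedSpace.exp ((-s) • S) =
        ContinuousLinearMap.adjoint (NormedSpace.exp (s • T)) := by
      rw [← ContinuousLinearMap.star_eq_adjoint, NormedSpace.star_exp, star_smul,
        ContinuousLinearMap.star_eq_adjoint, hS]
      simp
    rw [this, ContinuousLinearMap.adjoint_inner_right]
  have hq := fun s (hs : s ∈ Icc 0 t) => S.exp_neg_smul_apply_eq (g := fun σ => -r σ) hp hr.neg
    (fun s hs => by simpa [hS, sub_eq_add_neg] using hderiv s hs) hs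
  have hTc : Continuous fun σ : ℝ => NormedSpace.exp ((-σ) • T) :=
    T.exp_smul_continuous.comp continuous_neg
  have hSc : Continuous fun σ : ℝ => NormedSpace.exp ((-σ) • S) :=
    S.exp_smul_continuous.comp continuous_neg
  have hf' := hf.clm_apply_of_continuousOn hTc.continuousOn
  have hr' : IntervalIntegrable (fun σ => NormedSpace.exp ((-σ) • S) (-r σ)) volume 0 t := by
    refine ContinuousOn.intervalIntegrable ?_
    rw [uIcc_of_le ht]
    exact hSc.continuousOn.clm_apply hr.neg
  have h := intervalIntegral.integral_inner_primitive_add hf' hr' (p 0)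
  rw [← hq t ⟨ht, le_rfl⟩, hadj, ← hw t ⟨ht, le_rfl⟩] at h
  rw [← h]
  refine intervalIntegral.integral_congr fun s hs => ?_
  rw [uIcc_of_le ht] at hs
  rw [← hq s hs, hadj, hadj, ← hw s hs, T.exp_smul_exp_neg_smul_apply, inner_neg_right,
    sub_eq_add_neg]

/-! ### Matrices as operators on Euclidean space -/

section MatrixLemmas

variable {l m n : ℕ}

theorem Matrix.toEuclideanLin_mul_apply (M : Matrix (Fin l) (Fin m) ℝ) (N : Matrix (Fin m) (Fin n) ℝ)
    (x : EuclideanSpace ℝ (Fin n)) :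
    Matrix.toEuclideanLin (M * N) x = Matrix.toEuclideanLin M (Matrix.toEuclideanLin N x) := by
  simp [Matrix.toLpLin_apply, Matrix.mulVec_mulVec]

theorem Matrix.inner_toEuclideanLin_transpose (M : Matrix (Fin m) (Fin n) ℝ)
    (x : EuclideanSpace ℝ (Fin n)) (y : EuclideanSpace ℝ (Fin m)) :
    inner ℝ (Matrix.toEuclideanLin M x) y = inner ℝ x (Matrix.toEuclideanLin Mᵀ y) := by
  rw [← Matrix.conjTranspose_eq_transpose_of_trivial, Matrix.toEuclideanLin_conjTranspose_eq_adjoint,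
    LinearMap.adjoint_inner_right]

theorem EuclideanSpace.hasDerivAt_iff {f : ℝ → EuclideanSpace ℝ (Fin m)}
    {f' : EuclideanSpace ℝ (Fin m)} {s : ℝ} :
    HasDerivAt f f' s ↔ ∀ i, HasDerivAt (fun σ => f σ i) (f' i) s := by
  simp only [hasDerivAt_iff_hasFDerivAt, ← hasFDerivWithinAt_univ, hasFDerivWithinAt_euclidean]
  refine forall_congr' fun i => ?_
  rw [show PiLp.proj 2 (fun _ : Fin m => ℝ) i ∘L ContinuousLinearMap.toSpanSingleton ℝ f' =
    ContinuousLinearMap.toSpanSingleton ℝ (f' i) by ext; simp]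

theorem Matrix.toEuclideanCLM_exp (M : Matrix (Fin n) (Fin n) ℝ) :
    Matrix.toEuclideanCLM (𝕜 := ℝ) (NormedSpace.exp M) =
      NormedSpace.exp (Matrix.toEuclideanCLM (𝕜 := ℝ) M) := by
  -- The norm is auxiliary: the exponential depends only on the topology, which is the entrywise
  -- one.
  let _ : NormedRing (Matrix (Fin n) (Fin n) ℝ) := Matrix.linftyOpNormedRing
  let _ : NormedAlgebra ℝ (Matrix (Fin n) (Fin n) ℝ) := Matrix.linftyOpNormedAlgebra
  let _ : NormedAlgebra ℚ (Matrix (Fin n) (Fin n) ℝ) := NormedAlgebra.restrictScalars ℚ ℝ _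
  let _ : NormedAlgebra ℚ (EuclideanSpace ℝ (Fin n) →L[ℝ] EuclideanSpace ℝ (Fin n)) :=
    NormedAlgebra.restrictScalars ℚ ℝ _
  refine NormedSpace.map_exp (Matrix.toEuclideanCLM (𝕜 := ℝ) (n := Fin n)) ?_ M
  exact LinearMap.continuous_of_finiteDimensional
    (Matrix.toEuclideanCLM (𝕜 := ℝ) (n := Fin n)).toAlgEquiv.toLinearMap

theorem Matrix.hasDerivAt_toEuclideanLin_apply {P : ℝ → Matrix (Fin m) (Fin n) ℝ}
    {P' : Matrix (Fin m) (Fin n) ℝ} {y : ℝ → EuclideanSpace ℝ (Fin n)}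
    {y' : EuclideanSpace ℝ (Fin n)} {s : ℝ} (hP : HasDerivAt P P' s) (hy : HasDerivAt y y' s) :
    HasDerivAt (fun σ => Matrix.toEuclideanLin (P σ) (y σ))
      (Matrix.toEuclideanLin P' (y s) + Matrix.toEuclideanLin (P s) y') s := by
  rw [EuclideanSpace.hasDerivAt_iff] at *
  intro i
  have hP' : ∀ j, HasDerivAt (fun σ => P σ i j) (P' i j) s := fun j =>
    hasDerivAt_pi.1 (hasDerivAt_pi.1 hP i) j
  have := HasDerivAt.fun_sum (u := Finset.univ) fun j _ => (hP' j).mul (hy j)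
  convert! this using 1
  simp [Matrix.toLpLin_apply, Matrix.mulVec, dotProduct, Finset.sum_add_distrib]

theorem Matrix.continuousOn_toEuclideanLin_apply {P : ℝ → Matrix (Fin m) (Fin n) ℝ}
    {y : ℝ → EuclideanSpace ℝ (Fin n)} {S : Set ℝ} (hP : ContinuousOn P S)
    (hy : ContinuousOn y S) :
    ContinuousOn (fun σ => Matrix.toEuclideanLin (P σ) (y σ)) S := by
  have : ContinuousOn (fun σ => (P σ) *ᵥ (y σ).ofLp) S := by
    rw [continuousOn_iff_continuous_domRestrict] at *
    exact hP.matrix_mulVec ((PiLp.continuous_ofLp 2 _).comp hy)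
  exact (PiLp.continuous_toLp 2 _).comp_continuousOn this

theorem Matrix.PosSemidef.inner_toEuclideanLin_nonneg {M : Matrix (Fin n) (Fin n) ℝ}
    (hM : M.PosSemidef) (y : EuclideanSpace ℝ (Fin n)) :
    0 ≤ inner ℝ y (Matrix.toEuclideanLin M y) := by
  have := (Matrix.isPositive_toEuclideanLin_iff.2 hM).re_inner_nonneg_right y
  simpa using this

end MatrixLemmas

/-! ### Controls and their trajectories -/

namespace RegulatorData

noncomputable section Dynamics

variable {n m : ℕ} {d : RegulatorData n m} {t : ℝ} {x : EuclideanSpace ℝ (Fin n)}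
  {u v : ℝ → EuclideanSpace ℝ (Fin m)}

theorem intervalIntegrable_of_mem_controls (ht : 0 ≤ t) (hu : u ∈ d.controls t) :
    IntervalIntegrable u volume 0 t := by
  have : IntegrableOn u (Icc 0 t) := MemLp.integrable (by norm_num) hu
  rw [intervalIntegrable_iff_integrableOn_Icc_of_le ht]
  exact this

theorem intervalIntegrable_norm_sq_of_mem_controls (ht : 0 ≤ t) (hu : u ∈ d.controls t) :
    IntervalIntegrable (fun s => ‖u s‖ ^ 2) volume 0 t := by
  have : IntegrableOn (fun s => ‖u s‖ ^ 2) (Icc 0 t) := MemLp.integrable_norm_pow hu (by norm_num)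
  rw [intervalIntegrable_iff_integrableOn_Icc_of_le ht]
  exact this

theorem mem_controls_of_continuousOn (hu : ContinuousOn u (Icc 0 t)) : u ∈ d.controls t := by
  obtain ⟨C, hC⟩ := isCompact_Icc.exists_bound_of_continuousOn hu
  exact MemLp.of_bound (hu.aestronglyMeasurable measurableSet_Icc) C
    (ae_restrict_of_forall_mem measurableSet_Icc hC)

theorem exp_smul_toEuclideanLin_apply (s : ℝ) (y : EuclideanSpace ℝ (Fin n)) :
    Matrix.toEuclideanLin (NormedSpace.exp (s • d.A)) y =
      NormedSpace.exp (s • Matrix.toEuclideanCLM (𝕜 := ℝ) d.A) y := by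
  rw [← map_smul, ← Matrix.toEuclideanCLM_exp]
  rfl

theorem intervalIntegrable_toEuclideanLin (N : Matrix (Fin n) (Fin m) ℝ)
    (hu : IntervalIntegrable u volume 0 t) :
    IntervalIntegrable (fun s => Matrix.toEuclideanLin N (u s)) volume 0 t :=
  hu.clm_apply_of_continuousOn
    (Φ := fun _ => (Matrix.toEuclideanLin N).toContinuousLinearMap) continuousOn_const

theorem intervalIntegrable_exp_toEuclideanLin (hu : IntervalIntegrable u volume 0 t) :
    IntervalIntegrable (fun σ => NormedSpace.exp ((-σ) • Matrix.toEuclideanCLM (𝕜 := ℝ) d.A)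
      (Matrix.toEuclideanLin d.B (u σ))) volume 0 t :=
  (intervalIntegrable_toEuclideanLin d.B hu).clm_apply_of_continuousOn
    ((ContinuousLinearMap.exp_smul_continuous _).comp continuous_neg).continuousOn

/-- Pulling `exp(sA)` out of the integral makes the integrand independent of `s`, so that the
trajectory is an exponential applied to a genuine primitive. -/
theorem traj_eq (hu : IntervalIntegrable u volume 0 t) {s : ℝ} (hs : s ∈ Icc 0 t) :
    d.traj x u s = NormedSpace.exp (s • Matrix.toEuclideanCLM (𝕜 := ℝ) d.A)
      (x + ∫ σ in (0 : ℝ)..s, NormedSpace.exp ((-σ) • Matrix.toEuclideanCLM (𝕜 := ℝ) d.A)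
        (Matrix.toEuclideanLin d.B (u σ))) := by
  rw [traj, map_add, exp_smul_toEuclideanLin_apply, ← ContinuousLinearMap.intervalIntegral_comp_comm]
  · congr 1
    refine intervalIntegral.integral_congr fun σ _ => ?_
    rw [Matrix.toEuclideanLin_mul_apply, exp_smul_toEuclideanLin_apply,
      ← ContinuousLinearMap.exp_add_smul_apply, sub_eq_add_neg]
  · refine (intervalIntegrable_exp_toEuclideanLin hu).mono_set ?_
    rw [uIcc_of_le hs.1, uIcc_of_le (hs.1.trans hs.2)]
    exact Icc_subset_Icc_right hs.2

theorem traj_continuousOn (ht : 0 ≤ t) (hu : IntervalIntegrable u volume 0 t) :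
    ContinuousOn (d.traj x u) (Icc 0 t) := by
  have h := intervalIntegral.continuousOn_primitive_interval'
    (intervalIntegrable_exp_toEuclideanLin (d := d) hu) left_mem_uIcc
  rw [uIcc_of_le ht] at h
  exact ((ContinuousLinearMap.exp_smul_continuous _).continuousOn.clm_apply
    (continuousOn_const.add h)).congr fun s hs => traj_eq hu hs

/-- The common initial state drops out; the difference has the form required by
`ContinuousLinearMap.inner_adjoint_dynamics`. -/
theorem traj_sub_traj (hu : IntervalIntegrable u volume 0 t)
    (hv : IntervalIntegrable v volume 0 t) {s : ℝ} (hs : s ∈ Icc 0 t) :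
    d.traj x u s - d.traj x v s = NormedSpace.exp (s • Matrix.toEuclideanCLM (𝕜 := ℝ) d.A)
      (∫ σ in (0 : ℝ)..s, NormedSpace.exp ((-σ) • Matrix.toEuclideanCLM (𝕜 := ℝ) d.A)
        (Matrix.toEuclideanLin d.B (u σ - v σ))) := by
  have hsub : uIcc 0 s ⊆ uIcc 0 t := by
    rw [uIcc_of_le hs.1, uIcc_of_le (hs.1.trans hs.2)]
    exact Icc_subset_Icc_right hs.2
  rw [traj_eq hu hs, traj_eq hv hs, ← map_sub, add_sub_add_left_eq_sub,
    ← intervalIntegral.integral_sub ((intervalIntegrable_exp_toEuclideanLin hu).mono_set hsub)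
      ((intervalIntegrable_exp_toEuclideanLin hv).mono_set hsub)]
  simp only [map_sub]

end Dynamics

end RegulatorData

/-! ### Costate and comparison of costs -/

namespace RegulatorData

noncomputable section Costs

variable {n m : ℕ} {d : RegulatorData n m} {t M : ℝ} {x : EuclideanSpace ℝ (Fin n)}
  {u v : ℝ → EuclideanSpace ℝ (Fin m)} {α : ℝ → ℝ}
  {P : ℝ → Matrix (Fin n) (Fin n) ℝ} {Q ξ y : ℝ → EuclideanSpace ℝ (Fin n)}

/-! ### Consequences of the boundary value problem -/

namespace IsTPBVPSolution

theorem costate_continuousOn (h : d.IsTPBVPSolution t M x P Q ξ) :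
    ContinuousOn (fun s => Matrix.toEuclideanLin (P s) (ξ s) + Q s) (Icc 0 t) :=
  (Matrix.continuousOn_toEuclideanLin_apply h.P_cont h.ξ_cont).add h.Q_cont

/-- The costate `P ξ + Q` solves the adjoint equation. -/
theorem costate_hasDerivAt (h : d.IsTPBVPSolution t M x P Q ξ) {s : ℝ} (hs : s ∈ Ioo 0 t) :
    HasDerivAt (fun s => Matrix.toEuclideanLin (P s) (ξ s) + Q s)
      (-(ContinuousLinearMap.adjoint (Matrix.toEuclideanCLM (𝕜 := ℝ) d.A)
          (Matrix.toEuclideanLin (P s) (ξ s) + Q s)) -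
        (d.K + d.aInv (d.feedbackBarrierInput M ξ s)) • ξ s) s := by
  have hadj : ∀ z, ContinuousLinearMap.adjoint (Matrix.toEuclideanCLM (𝕜 := ℝ) d.A) z =
      Matrix.toEuclideanLin d.Aᵀ z := fun z => by
    rw [← ContinuousLinearMap.star_eq_adjoint, ← map_star, Matrix.star_eq_conjTranspose,
      Matrix.conjTranspose_eq_transpose_of_trivial]
    rfl
  have hsymm : (P s)ᵀ = P s := by
    rw [← Matrix.conjTranspose_eq_transpose_of_trivial]
    exact (h.P_posSemidef s (Ioo_subset_Icc_self hs)).1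
  have hone : ∀ z : EuclideanSpace ℝ (Fin n), Matrix.toEuclideanLin (1 : Matrix _ _ ℝ) z = z :=
    fun z => by simp
  convert! (Matrix.hasDerivAt_toEuclideanLin_apply (h.P_eq s hs) (h.ξ_eq s hs)).add
    (h.Q_eq s hs) using 1
  -- The terms `PAξ`, `PBB'Pξ` and `PBB'Q` cancel in `P'ξ + Pξ' + Q'`; symmetry of `P` is needed for
  -- the last of them.
  rw [hadj, feedbackBarrierInput]
  simp only [Matrix.transpose_sub, Matrix.transpose_smul, Matrix.transpose_mul, hsymm,
    Matrix.transpose_transpose, map_add, map_sub, map_neg, map_smul, LinearMap.add_apply,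
    LinearMap.sub_apply, LinearMap.neg_apply, LinearMap.smul_apply,
    Matrix.toEuclideanLin_mul_apply, hone]
  module

theorem feedbackControl_continuousOn (h : d.IsTPBVPSolution t M x P Q ξ) :
    ContinuousOn (d.feedbackControl P Q ξ) (Icc 0 t) :=
  (Matrix.continuousOn_toEuclideanLin_apply (P := fun _ => d.Bᵀ) continuousOn_const
    h.costate_continuousOn).const_smul (-(1 / d.κ))

theorem feedbackControl_mem (h : d.IsTPBVPSolution t M x P Q ξ) :
    d.feedbackControl P Q ξ ∈ d.controls t :=
  mem_controls_of_continuousOn h.feedbackControl_continuousOn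

theorem traj_feedbackControl (ht : 0 ≤ t) (h : d.IsTPBVPSolution t M x P Q ξ) {s : ℝ}
    (hs : s ∈ Icc 0 t) : d.traj x (d.feedbackControl P Q ξ) s = ξ s := by
  have hg : ContinuousOn (fun s => Matrix.toEuclideanLin d.B (d.feedbackControl P Q ξ s))
      (Icc 0 t) :=
    Matrix.continuousOn_toEuclideanLin_apply continuousOn_const h.feedbackControl_continuousOn
  -- The closed-loop equation for `ξ` is `ξ' = Aξ + Bu*` once the feedback is substituted.
  have hξ := ContinuousLinearMap.exp_neg_smul_apply_eq (Matrix.toEuclideanCLM (𝕜 := ℝ) d.A)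
    h.ξ_cont hg (fun s hs => by
      convert! h.ξ_eq s hs using 1
      have : Matrix.toEuclideanCLM (𝕜 := ℝ) d.A (ξ s) = Matrix.toEuclideanLin d.A (ξ s) := rfl
      rw [this, feedbackControl]
      simp only [map_add, map_sub, map_smul, LinearMap.sub_apply, LinearMap.smul_apply,
        Matrix.toEuclideanLin_mul_apply]
      module) hs
  rw [traj_eq (intervalIntegrable_of_mem_controls ht h.feedbackControl_mem) hs, ← h.ξ_init, ← hξ,
    ContinuousLinearMap.exp_smul_exp_neg_smul_apply]

end IsTPBVPSolution

/-! ### Regularity and comparison of the costs -/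

theorem Admissible.feedbackBarrierInput_mem (hd : d.Admissible) (hM : -d.φ 0 ≤ M)
    (hy : ContinuousOn y (Icc 0 t)) : d.feedbackBarrierInput M y ∈ d.barrierInputs t M :=
  ⟨(hd.αHat_continuousOn hM).comp (hy.norm.pow 2) fun s _ => sq_nonneg ‖y s‖,
    fun _ _ => hd.αHat_mem hM (sq_nonneg _)⟩

theorem Admissible.aInv_comp_continuousOn (hd : d.Admissible) (hα : α ∈ d.barrierInputs t M) :
    ContinuousOn (fun s => d.aInv (α s)) (Icc 0 t) :=
  hd.aInv_continuousOn.comp hα.1 fun _ hs => (hα.2 hs).1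

theorem Admissible.ν_continuousOn (hd : d.Admissible) (hy : ContinuousOn y (Icc 0 t))
    (hα : α ∈ d.barrierInputs t M) : ContinuousOn (fun s => d.ν (y s) (α s)) (Icc 0 t) :=
  (continuousOn_const.mul (hy.norm.pow 2)).add (continuousOn_const.mul
    (((hd.aInv_comp_continuousOn hα).mul (hy.norm.pow 2)).sub hα.1))

theorem gameCost_congr (ht : 0 ≤ t) {β : ℝ → ℝ} (h : EqOn α β (Icc 0 t)) :
    d.gameCost t x u α = d.gameCost t x u β := by
  have : ∫ s in (0 : ℝ)..t, d.ν (d.traj x u s) (α s) =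
      ∫ s in (0 : ℝ)..t, d.ν (d.traj x u s) (β s) :=
    intervalIntegral.integral_congr fun s hs => by
      rw [uIcc_of_le ht] at hs
      rw [h hs]
  rw [gameCost, gameCost, this]

/-- This reduces the regulator problem to the game in which the second player responds optimally to
the trajectory at each time. -/
theorem Admissible.costM_eq_gameCost (hd : d.Admissible) (hM : -d.φ 0 ≤ M) :
    d.costM t M x u = d.gameCost t x u (d.feedbackBarrierInput M (d.traj x u)) := by
  simp only [costM, gameCost, ν, feedbackBarrierInput, hd.barrierM_eq hM (sq_nonneg _)]

theorem Admissible.ν_le (hd : d.Admissible) (hM : -d.φ 0 ≤ M) (y : EuclideanSpace ℝ (Fin n))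
    {α : ℝ} (hα : α ∈ Icc (-d.φ 0) M) : d.ν y α ≤ d.ν y (d.αHat M (‖y‖ ^ 2)) := by
  have := hd.le_αHat hM (sq_nonneg ‖y‖) hα
  simp only [ν]
  linarith

theorem Admissible.gameCost_le (hd : d.Admissible) (hM : -d.φ 0 ≤ M) (ht : 0 ≤ t)
    (hu : u ∈ d.controls t) (hα : α ∈ d.barrierInputs t M) :
    d.gameCost t x u α ≤ d.gameCost t x u (d.feedbackBarrierInput M (d.traj x u)) := by
  have hy := traj_continuousOn (d := d) (x := x) ht (intervalIntegrable_of_mem_controls ht hu)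
  have : ∫ s in (0 : ℝ)..t, d.ν (d.traj x u s) (α s) ≤
      ∫ s in (0 : ℝ)..t, d.ν (d.traj x u s) (d.feedbackBarrierInput M (d.traj x u) s) :=
    intervalIntegral.integral_mono_on ht
      (ContinuousOn.intervalIntegrable_of_Icc ht (hd.ν_continuousOn hy hα))
      (ContinuousOn.intervalIntegrable_of_Icc ht
        (hd.ν_continuousOn hy (hd.feedbackBarrierInput_mem hM hy)))
      fun s hs => hd.ν_le hM _ (hα.2 hs)
  rw [gameCost, gameCost]
  gcongr

/-- Inputs are continuous, so a strict pointwise loss at a single time persists nearby and makes the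
integral strictly smaller. Hence equality holds at every time, not just almost everywhere. -/
theorem Admissible.eqOn_of_gameCost_le (hd : d.Admissible) (hM : -d.φ 0 ≤ M) (ht : 0 < t)
    (hu : u ∈ d.controls t) (hα : α ∈ d.barrierInputs t M)
    (hle : d.gameCost t x u (d.feedbackBarrierInput M (d.traj x u)) ≤ d.gameCost t x u α) :
    EqOn α (d.feedbackBarrierInput M (d.traj x u)) (Icc 0 t) := by
  have hy := traj_continuousOn (d := d) (x := x) ht.le
    (intervalIntegrable_of_mem_controls ht.le hu)
  by_contra hne
  simp only [EqOn, not_forall] at hne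
  obtain ⟨s, hs, hne⟩ := hne
  have hlt := intervalIntegral.integral_lt_integral_of_continuousOn_of_le_of_exists_lt ht
    (hd.ν_continuousOn hy hα) (hd.ν_continuousOn hy (hd.feedbackBarrierInput_mem hM hy))
    (fun s hs => hd.ν_le hM _ (hα.2 (Ioc_subset_Icc_self hs)))
    ⟨s, hs, by
      have := hd.lt_αHat hM (sq_nonneg ‖d.traj x u s‖) (hα.2 hs) hne
      simp only [ν, feedbackBarrierInput]
      linarith⟩
  rw [gameCost, gameCost] at hle
  linarith

/-- Convexity of the quadratic `Ψ`: the discarded remainder is `½⟨w, Pt w⟩ ≥ 0`. -/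
theorem Admissible.terminalCost_add_le (hd : d.Admissible) (y w : EuclideanSpace ℝ (Fin n)) :
    d.terminalCost y + inner ℝ w (Matrix.toEuclideanLin d.Pt (y - d.z)) ≤
      d.terminalCost (y + w) := by
  have hnn := hd.Pt_posSemidef.inner_toEuclideanLin_nonneg w
  have hsymm : inner ℝ (y - d.z) (Matrix.toEuclideanLin d.Pt w) =
      inner ℝ w (Matrix.toEuclideanLin d.Pt (y - d.z)) := by
    rw [real_inner_comm, Matrix.inner_toEuclideanLin_transpose,
      ← Matrix.conjTranspose_eq_transpose_of_trivial, hd.Pt_posSemidef.1]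
  rw [terminalCost, terminalCost, show y + w - d.z = (y - d.z) + w by abel, map_add,
    inner_add_left, inner_add_right, inner_add_right, hsymm]
  linarith

/-- The cost of the game is strongly convex in the control, with minimizer the feedback control. -/
theorem IsTPBVPSolution.gameCost_add_le (h : d.IsTPBVPSolution t M x P Q ξ) (hd : d.Admissible)
    (hM : -d.φ 0 ≤ M) (ht : 0 ≤ t) (hu : u ∈ d.controls t) :
    d.gameCost t x (d.feedbackControl P Q ξ) (d.feedbackBarrierInput M ξ) +
        d.κ / 2 * ∫ s in (0 : ℝ)..t, ‖u s - d.feedbackControl P Q ξ s‖ ^ 2 ≤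
      d.gameCost t x u (d.feedbackBarrierInput M ξ) := by
  set v := d.feedbackControl P Q ξ
  set α := d.feedbackBarrierInput M ξ with hα_def
  set p := fun s => Matrix.toEuclideanLin (P s) (ξ s) + Q s
  set r := fun s => (d.K + d.aInv (α s)) • ξ s with hr_def
  set w := fun s => d.traj x u s - ξ s with hw_def
  have hv : v ∈ d.controls t := h.feedbackControl_mem
  have huI := intervalIntegrable_of_mem_controls ht hu
  have hvI := intervalIntegrable_of_mem_controls ht hv
  have hα : α ∈ d.barrierInputs t M := hd.feedbackBarrierInput_mem hM h.ξ_cont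
  have hp : ContinuousOn p (Icc 0 t) := h.costate_continuousOn
  have hr : ContinuousOn r (Icc 0 t) :=
    (continuousOn_const.add (hd.aInv_comp_continuousOn hα)).smul h.ξ_cont
  have hy : ContinuousOn (d.traj x u) (Icc 0 t) := traj_continuousOn ht huI
  have hw : ContinuousOn w (Icc 0 t) := hy.sub h.ξ_cont
  have hBI : IntervalIntegrable (fun s => Matrix.toEuclideanLin d.B (u s - v s)) volume 0 t :=
    intervalIntegrable_toEuclideanLin d.B (huI.sub hvI)
  -- The state deviation `w` is driven by `B(u - v)`. Pairing it with the costate turns the terminal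
  -- first variation into an integral.
  have hpair := ContinuousLinearMap.inner_adjoint_dynamics (Matrix.toEuclideanCLM (𝕜 := ℝ) d.A)
    (w := w) ht hBI hp hr (fun s hs => h.costate_hasDerivAt hs)
    (fun s hs => by
      simp only [hw_def]
      rw [← h.traj_feedbackControl ht hs]
      exact traj_sub_traj huI hvI hs)
  -- The final conditions say that `p t = Pt (ξ t - z)`, the gradient of `Ψ` at `ξ t`.
  have hterm : d.terminalCost (ξ t) + inner ℝ (w t) (p t) ≤ d.terminalCost (d.traj x u t) := by
    have := hd.terminalCost_add_le (ξ t) (w t)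
    rw [map_sub, sub_eq_add_neg, ← h.Q_final, ← h.P_final] at this
    simpa [hw_def] using this
  -- Expanding the squares around `(ξ, v)`, the first-order terms are exactly the pairing integrand,
  -- because `B'p = -κv` and `r = (K + a⁻¹(α))ξ`. What is discarded is `½(K + a⁻¹(α))|w|² ≥ 0`.
  have hpt : ∀ s ∈ Icc 0 t, d.ν (ξ s) (α s) + d.κ / 2 * ‖v s‖ ^ 2 +
      d.κ / 2 * ‖u s - v s‖ ^ 2 -
        (inner ℝ (Matrix.toEuclideanLin d.B (u s - v s)) (p s) - inner ℝ (w s) (r s)) ≤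
      d.ν (d.traj x u s) (α s) + d.κ / 2 * ‖u s‖ ^ 2 := by
    intro s hs
    have hB : inner ℝ (Matrix.toEuclideanLin d.B (u s - v s)) (p s) =
        -d.κ * inner ℝ (u s - v s) (v s) := by
      have hκ := hd.κ_pos.ne'
      rw [Matrix.inner_toEuclideanLin_transpose]
      have : v s = -(1 / d.κ) • Matrix.toEuclideanLin d.Bᵀ (p s) := rfl
      conv_rhs => rw [show inner ℝ (u s - v s) (v s) = inner ℝ (u s - v s)
        (-(1 / d.κ) • Matrix.toEuclideanLin d.Bᵀ (p s)) by rw [← this]]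
      rw [inner_smul_right]
      field_simp
    have h1 : ‖u s‖ ^ 2 = ‖v s‖ ^ 2 + 2 * inner ℝ (u s - v s) (v s) + ‖u s - v s‖ ^ 2 := by
      rw [real_inner_comm, ← norm_add_sq_real, add_sub_cancel]
    have h2 : ‖d.traj x u s‖ ^ 2 = ‖ξ s‖ ^ 2 + 2 * inner ℝ (w s) (ξ s) + ‖w s‖ ^ 2 := by
      rw [real_inner_comm, ← norm_add_sq_real, hw_def, add_sub_cancel]
    have h3 := mul_nonneg (hd.K_add_aInv_nonneg (hα.2 hs).1) (sq_nonneg ‖w s‖)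
    rw [hB, hr_def, inner_smul_right, ν, ν, h1, h2]
    linarith
  have hνξ := (hd.ν_continuousOn h.ξ_cont hα).intervalIntegrable_of_Icc (μ := volume) ht
  have hνy := (hd.ν_continuousOn hy hα).intervalIntegrable_of_Icc (μ := volume) ht
  have huv := intervalIntegrable_norm_sq_of_mem_controls (d := d) ht
    (show (fun s => u s - v s) ∈ d.controls t from MemLp.sub hu hv)
  have hu2 := intervalIntegrable_norm_sq_of_mem_controls ht hu
  have hv2 := intervalIntegrable_norm_sq_of_mem_controls ht hv
  have hg : IntervalIntegrable (fun s => inner ℝ (Matrix.toEuclideanLin d.B (u s - v s)) (p s) -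
      inner ℝ (w s) (r s)) volume 0 t :=
    (hBI.bilin_continuousOn (innerSL ℝ) (by rwa [uIcc_of_le ht])).sub
      ((hw.inner hr).intervalIntegrable_of_Icc ht)
  have hmono := intervalIntegral.integral_mono_on ht
    (((hνξ.add (hv2.const_mul (d.κ / 2))).add (huv.const_mul (d.κ / 2))).sub hg)
    (hνy.add (hu2.const_mul (d.κ / 2))) hpt
  rw [intervalIntegral.integral_sub ((hνξ.add (hv2.const_mul _)).add (huv.const_mul _)) hg,
    intervalIntegral.integral_add (hνξ.add (hv2.const_mul _)) (huv.const_mul _),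
    intervalIntegral.integral_add hνξ (hv2.const_mul _),
    intervalIntegral.integral_add hνy (hu2.const_mul _), ← hpair,
    intervalIntegral.integral_const_mul, intervalIntegral.integral_const_mul,
    intervalIntegral.integral_const_mul] at hmono
  have hνv : ∫ s in (0 : ℝ)..t, d.ν (d.traj x v s) (α s) =
      ∫ s in (0 : ℝ)..t, d.ν (ξ s) (α s) :=
    intervalIntegral.integral_congr fun s hs => by
      rw [uIcc_of_le ht] at hs
      rw [h.traj_feedbackControl ht hs]
  rw [gameCost, gameCost, hνv, h.traj_feedbackControl ht ⟨ht, le_rfl⟩, controlCost, controlCost]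
  linarith

theorem sameControl_of_integral_nonpos (ht : 0 ≤ t) (hu : u ∈ d.controls t)
    (hv : v ∈ d.controls t) (h : ∫ s in (0 : ℝ)..t, ‖u s - v s‖ ^ 2 ≤ 0) :
    d.SameControl t u v := by
  have hint : IntegrableOn (fun s => ‖u s - v s‖ ^ 2) (Icc 0 t) :=
    MemLp.integrable_norm_pow (MemLp.sub hu hv) (by norm_num)
  rw [intervalIntegral.integral_of_le ht, ← integral_Icc_eq_integral_Ioc] at h
  have h0 := (setIntegral_eq_zero_iff_of_nonneg_ae
    (Eventually.of_forall fun s => sq_nonneg ‖u s - v s‖) hint).1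
    (le_antisymm h (integral_nonneg fun s => sq_nonneg ‖u s - v s‖))
  filter_upwards [h0] with s hs
  exact sub_eq_zero.1 (norm_eq_zero.1 (pow_eq_zero_iff two_ne_zero |>.1 hs))

/-- Stated for a general `F` so as to serve both the regulator cost and the game cost against `α*`.
-/
theorem isUniqueMinimizer_of_add_le {F : (ℝ → EuclideanSpace ℝ (Fin m)) → ℝ} (hκ : 0 < d.κ)
    (ht : 0 ≤ t) (hv : v ∈ d.controls t)
    (h : ∀ u ∈ d.controls t, F v + d.κ / 2 * ∫ s in (0 : ℝ)..t, ‖u s - v s‖ ^ 2 ≤ F u) :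
    d.IsUniqueMinimizer t F v := by
  refine ⟨hv, fun u hu => ?_, fun u hu hmin => sameControl_of_integral_nonpos ht hu hv ?_⟩
  · have h0 : 0 ≤ ∫ s in (0 : ℝ)..t, ‖u s - v s‖ ^ 2 :=
      intervalIntegral.integral_nonneg ht fun s _ => sq_nonneg _
    have := h u hu
    have := mul_nonneg (half_pos hκ).le h0
    show F v ≤ F u
    linarith
  · have h1 : F u ≤ F v := hmin hv
    have h2 := h u hu
    by_contra! h0
    have := mul_pos (half_pos hκ) h0
    linarith

end Costs

end RegulatorData

/-! ### Saddle point and common value -/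

theorem mainTheorem11 {n m : ℕ} (d : RegulatorData n m) (hd : d.Admissible)
    (t : ℝ) (ht : 0 < t) (M : ℝ) (hM : -d.φ 0 ≤ M) (x : EuclideanSpace ℝ (Fin n))
    (P : ℝ → Matrix (Fin n) (Fin n) ℝ) (Q ξ : ℝ → EuclideanSpace ℝ (Fin n))
    (hsol : d.IsUniqueTPBVPSolution t M x P Q ξ) :
    -- the feedback control is the unique optimal control of the approximate regulator problem
    d.IsUniqueMinimizer t (d.costM t M x) (d.feedbackControl P Q ξ) ∧
    -- it generates the state trajectory `ξ`, so that the second feedback is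
    -- the maximizing input associated with this optimal control
    (∀ s ∈ Icc 0 t, d.traj x (d.feedbackControl P Q ξ) s = ξ s) ∧
    -- the value of the second feedback is the unique maximizer, and is explicit
    (∀ s ∈ Icc 0 t,
      (∀ α ∈ Icc (-d.φ 0) M, α ≠ d.feedbackBarrierInput M ξ s →
        d.aInv α * ‖ξ s‖ ^ 2 - α <
          d.aInv (d.feedbackBarrierInput M ξ s) * ‖ξ s‖ ^ 2 - d.feedbackBarrierInput M ξ s) ∧
      (‖ξ s‖ ^ 2 ≤ d.ρHat M → d.feedbackBarrierInput M ξ s = d.a (d.φ' (‖ξ s‖ ^ 2))) ∧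
      (d.ρHat M < ‖ξ s‖ ^ 2 → d.feedbackBarrierInput M ξ s = M)) ∧
    -- the feedback control is the unique best response to the second feedback
    d.IsUniqueMinimizer t (fun u => d.gameCost t x u (d.feedbackBarrierInput M ξ))
      (d.feedbackControl P Q ξ) ∧
    -- the two feedbacks form the unique saddle point of the approximate game
    d.IsSaddle t M x (d.feedbackControl P Q ξ) (d.feedbackBarrierInput M ξ) ∧
    (∀ u α, d.IsSaddle t M x u α →
      d.SameControl t u (d.feedbackControl P Q ξ) ∧
        EqOn α (d.feedbackBarrierInput M ξ) (Icc 0 t)) ∧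
    -- and they attain the common value
    d.valueM t M x =
      ((d.gameCost t x (d.feedbackControl P Q ξ) (d.feedbackBarrierInput M ξ) : ℝ) : EReal) ∧
    d.upperValue t M x =
      ((d.gameCost t x (d.feedbackControl P Q ξ) (d.feedbackBarrierInput M ξ) : ℝ) : EReal) ∧
    d.lowerValue t M x =
      ((d.gameCost t x (d.feedbackControl P Q ξ) (d.feedbackBarrierInput M ξ) : ℝ) : EReal) := by
  have h := hsol.1
  set u := d.feedbackControl P Q ξ
  set α := d.feedbackBarrierInput M ξ with hα_def
  have hu : u ∈ d.controls t := h.feedbackControl_mem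
  have htraj : ∀ s ∈ Icc 0 t, d.traj x u s = ξ s := fun s hs => h.traj_feedbackControl ht.le hs
  have hα : α ∈ d.barrierInputs t M := hd.feedbackBarrierInput_mem hM h.ξ_cont
  have hαeq : EqOn (d.feedbackBarrierInput M (d.traj x u)) α (Icc 0 t) := fun s hs => by
    simp only [RegulatorData.feedbackBarrierInput, hα_def, htraj s hs]
  have hgc := RegulatorData.gameCost_congr (d := d) (x := x) (u := u) ht.le hαeq
  have hcost : d.costM t M x u = d.gameCost t x u α := by
    rw [hd.costM_eq_gameCost hM, hgc]
  have hmin := fun v hv => h.gameCost_add_le hd hM ht.le (u := v) hv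
  have hle : ∀ v ∈ d.controls t, ∀ β ∈ d.barrierInputs t M,
      d.gameCost t x v β ≤ d.costM t M x v := fun v hv β hβ => by
    rw [hd.costM_eq_gameCost hM]
    exact hd.gameCost_le hM ht.le hv hβ
  -- The regulator cost lies above `J(·,α*)` and touches it at `u*`, so it inherits the quadratic
  -- growth.
  have hminM : d.IsUniqueMinimizer t (d.costM t M x) u :=
    RegulatorData.isUniqueMinimizer_of_add_le hd.κ_pos ht.le hu fun v hv => by
      rw [hcost]
      exact (hmin v hv).trans (hle v hv α hα)
  have hminJ : d.IsUniqueMinimizer t (fun v => d.gameCost t x v α) u :=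
    RegulatorData.isUniqueMinimizer_of_add_le hd.κ_pos ht.le hu hmin
  have hmaxJ : ∀ β ∈ d.barrierInputs t M, d.gameCost t x u β ≤ d.gameCost t x u α :=
    fun β hβ => (hle u hu β hβ).trans_eq hcost
  have hlower : ((d.gameCost t x u α : ℝ) : EReal) ≤ d.lowerValue t M x :=
    le_iSup₂_of_le α hα (le_iInf₂ fun v hv => EReal.coe_le_coe_iff.2 (hminJ.2.1 hv))
  have hupper : d.upperValue t M x ≤ ((d.gameCost t x u α : ℝ) : EReal) :=
    iInf₂_le_of_le u hu (iSup₂_le fun β hβ => EReal.coe_le_coe_iff.2 (hmaxJ β hβ))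
  have hlu : d.lowerValue t M x ≤ d.upperValue t M x :=
    iSup₂_le fun β hβ => le_iInf₂ fun v hv =>
      (iInf₂_le v hv).trans (le_iSup₂ (f := fun β' (_ : β' ∈ d.barrierInputs t M) =>
        ((d.gameCost t x v β' : ℝ) : EReal)) β hβ)
  refine ⟨hminM, htraj, fun s hs => ⟨fun β hβ hne => hd.lt_αHat hM (sq_nonneg _) hβ hne,
    hd.αHat_of_le hM (sq_nonneg _), hd.αHat_of_lt hM (sq_nonneg _)⟩, hminJ,
    ⟨hu, hα, hmaxJ, fun v hv => hminJ.2.1 hv⟩, ?_, ?_, le_antisymm hupper (hlower.trans hlu),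
    le_antisymm (hlu.trans hupper) hlower⟩
  -- The chain `J(v,α*) ≤ J(v,β) ≤ J(u*,β) ≤ J(u*,α*) ≤ J(v,α*)` collapses to equalities. So `v`
  -- minimizes `J(·,α*)` and `β` maximizes `J(u*,·)`, and each of these optimizers is unique.
  · rintro v β ⟨hv, hβ, hβmax, hvmin⟩
    have h2 := hβmax α hα
    have h3 := hvmin u hu
    have h4 := hmaxJ β hβ
    constructor
    · refine hminJ.2.2 v hv fun v' hv' => ?_
      exact (h2.trans (h3.trans h4)).trans (hminJ.2.1 hv')
    · refine EqOn.trans (hd.eqOn_of_gameCost_le hM ht hu hβ ?_) hαeq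
      rw [hgc]
      exact (hminJ.2.1 hv).trans (h2.trans h3)
  · rw [← hcost]
    exact le_antisymm (iInf₂_le u hu) (le_iInf₂ fun v hv => EReal.coe_le_coe_iff.2 (hminM.2.1 hv))
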